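/- Let $K$ be a field and let $\mathbf Q$ be the poset of non-negative rational numbers, regarded as a category; write $\mathbf Q_\infty=\mathbf Q\cup\{\infty\}$. We consider functors $G\colon\mathbf Q\to\mathrm{Vect}_K$. For $a\in\mathbf Q$, let $K(a,-)$ be the functor with $K(a,b)=K$ if $a\le b$ and $K(a,b)=0$ otherwise, with identity maps between the copies of $K$. A functor $G$ is finitely generated if there is an epimorphism $\bigoplus_{s=1}^n K(a_s,-)\to G$ for some $n\ge 0$ and $a_1,\dots,a_n\in\mathbf Q$. It is tame if there are a rational $\alpha>0$ and a functor $F\colon\mathbf N\to\mathrm{Vect}_K$, where $\mathbf N$ is the poset of natural numbers, such that $G$ is isomorphic to $v\mapsto F(\lfloor v/\alpha\rfloor)$. A minimal cover of $G$ is an epimorphism $\phi\colon P\to G$ from a free functor $P$ such that every $f\colon P\to P$ with $\phi f=\phi$ is an isomorphism. For $G$ finitely generated and tame, a minimal cover exists, is unique up to isomorphism and has $P\cong\bigoplus_{s=1}^n K(a_s,-)$ for some finite $n$; the zeroth Betti number is $\operatorname{rank}_0G:=n$. For $u\in\mathbf Q$, the truncated standard persistence contour $S/u\colon\mathbf Q_\infty\times\mathbf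 Q\to\mathbf Q_\infty$ is given by $(S/u)(v,\epsilon)=v+\epsilon$ if $v+\epsilon<u$, and $(S/u)(v,\epsilon)=\infty$ otherwise. The truncation $\mathcal S/u$ of the standard noise system $\mathcal S$ at $u$ is the noise system whose component $(\mathcal S/u)_\epsilon$, for $\epsilon\in\mathbf Q$, consists of the finitely generated tame functors $G$ such that the map $G(v\le (S/u)(v,\epsilon))$ is zero for every $v\in\mathbf Q$ with $(S/u)(v,\epsilon)\ne\infty$. For $G$ finitely generated and tame and $\tau\in\mathbf Q$, let $G_{\mathcal S/u}[\tau]\subseteq G$ be the minimal (with respect to inclusion) tame subfunctor $G_0\subseteq G$ such that $G/G_0$ belongs to $(\mathcal S/u)_\tau$; it exists and is unique. **Proposition.** Let $F,G\colon\mathbf Q\to\mathrm{Vect}_K$ be finitely generated tame functors. Then $F$ and $G$ are isomorphic if and only if $$\operatorname{rank}_0F_{\mathcal S/u}[\tau]=\operatorname{rank}_0G_{\mathcal S/u}[\tau]\qquad\text{for all }\tau,u\in\mathbf Q .$$ -/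

import Mathlib

open CategoryTheory CategoryTheory.Limits
open scoped NNRat

universe u

namespace Persistence

/-- Functors from the poset of non-negative rational numbers to `K`-vector spaces. -/
abbrev PersFun (K : Type u) [Field K] := ℚ≥0 ⥤ ModuleCat.{u} K

section Tame

/-- The functor `v ↦ ⌊v / α⌋` from the non-negative rationals to the natural numbers. -/
def floorFunctor (α : ℚ≥0) : ℚ≥0 ⥤ ℕ :=
  Monotone.functor (f := fun v : ℚ≥0 => ⌊v / α⌋₊)
    (fun _ _ h => Nat.floor_mono (div_le_div_of_nonneg_right h zero_le))

variable {K : Type u} [Field K]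

/-- `G` is tame: for some resolution `α > 0`, it is isomorphic to `F ∘ ⌊α⁻¹ ·⌋` for some functor
`F` (a frame of `G`) indexed by the natural numbers. -/
def IsTame (G : PersFun K) : Prop :=
  ∃ α : ℚ≥0, 0 < α ∧ ∃ F : ℕ ⥤ ModuleCat.{u} K, Nonempty (G ≅ floorFunctor α ⋙ F)

end Tame

section Rank

/-- The free functor `⨁ s, K(i s, -)`: its value at `v` has as basis the set of those `s` with
`i s ≤ v`, and its structure maps are induced by the inclusions of these bases. -/
noncomputable def free (K : Type u) [Field K] {S : Type} (i : S → ℚ≥0) : PersFun K where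
  obj v := ModuleCat.of K ({s : S // i s ≤ v} →₀ K)
  map {_ _} f := ModuleCat.ofHom
    (Finsupp.lmapDomain K K fun s => ⟨s.1, s.2.trans (leOfHom f)⟩)
  map_id v := by
    ext1
    exact Finsupp.lmapDomain_id K K
  map_comp {a b c} f g := by
    ext1
    exact Finsupp.lmapDomain_comp K K
      (fun s : {s : S // i s ≤ a} => (⟨s.1, s.2.trans (leOfHom f)⟩ : {s : S // i s ≤ b}))
      (fun s : {s : S // i s ≤ b} => (⟨s.1, s.2.trans (leOfHom g)⟩ : {s : S // i s ≤ c}))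

variable {K : Type u} [Field K]

/-- `G` is finitely generated: it receives an epimorphism from a free functor on finitely many
generators. -/
def IsFinGen (G : PersFun K) : Prop :=
  ∃ (n : ℕ) (i : Fin n → ℚ≥0) (φ : free K i ⟶ G), Epi φ

/-- A morphism `φ : X ⟶ Y` is minimal if every endomorphism of `X` over `Y` is an isomorphism. -/
def IsMinimalHom {C : Type*} [Category C] {X Y : C} (φ : X ⟶ Y) : Prop :=
  ∀ f : X ⟶ X, f ≫ φ = φ → IsIso f

/-- The natural transformation `φ`, whose domain is free, is a minimal cover of `G`. -/
def IsMinimalCover {S : Type} {i : S → ℚ≥0} {G : PersFun K} (φ : free K i ⟶ G) : Prop :=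
  Epi φ ∧ IsMinimalHom φ

/-- The zeroth Betti number of `G`: the rank `n` of the free functor `P` in a minimal cover `P ⟶ G`.
Minimal covers being unique up to isomorphism, there is at most one such `n`, and there is one
if `G` is finitely generated and tame. -/
noncomputable def rank₀ (G : PersFun K) : ℕ :=
  sInf {n : ℕ | ∃ (i : Fin n → ℚ≥0) (φ : free K i ⟶ G), IsMinimalCover φ}

end Rank

/-- A persistence contour (in one parameter). -/
structure Contour where
  /-- the underlying function -/
  toFun : WithTop ℚ≥0 → ℚ≥0 → WithTop ℚ≥0
  mono : ∀ {v w : WithTop ℚ≥0} {τ ε : ℚ≥0}, v ≤ w → τ ≤ ε → toFun v τ ≤ toFun w ε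
  le_toFun : ∀ (v : WithTop ℚ≥0) (ε : ℚ≥0), v ≤ toFun v ε
  toFun_toFun_le : ∀ (v : WithTop ℚ≥0) (ε τ : ℚ≥0), toFun (toFun v ε) τ ≤ toFun v (ε + τ)

namespace Contour

/-- The standard contour `S(v, ε) = v + ε`. -/
def standard : Contour where
  toFun v ε := v + (ε : WithTop ℚ≥0)
  mono h₁ h₂ := add_le_add h₁ (WithTop.coe_le_coe.2 h₂)
  le_toFun _ _ := le_add_of_nonneg_right zero_le
  toFun_toFun_le v ε τ := by rw [WithTop.coe_add, add_assoc]

/-- The truncation `C / u` of the contour `C` at `u`. -/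
def truncate (C : Contour) (u : ℚ≥0) : Contour where
  toFun v ε := if (u : WithTop ℚ≥0) ≤ C.toFun v ε then ⊤ else C.toFun v ε
  mono {v w τ ε} h₁ h₂ := by
    have h := C.mono h₁ h₂
    split_ifs with h₃ h₄ h₄
    · exact le_rfl
    · exact absurd (h₃.trans h) h₄
    · exact le_top
    · exact h
  le_toFun v ε := by
    split_ifs
    · exact le_top
    · exact C.le_toFun v ε
  toFun_toFun_le v ε τ := by
    have h := C.toFun_toFun_le v ε τ
    have h' : C.toFun v ε ≤ C.toFun v (ε + τ) :=
      C.mono le_rfl (le_add_of_nonneg_right zero_le)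
    by_cases h₁ : (u : WithTop ℚ≥0) ≤ C.toFun v (ε + τ)
    · rw [if_pos h₁]
      exact le_top
    · have h₂ : ¬ (u : WithTop ℚ≥0) ≤ C.toFun v ε := fun h₂ => h₁ (h₂.trans h')
      rw [if_neg h₁, if_neg h₂, if_neg fun h₃ => h₁ (h₃.trans h)]
      exact h

variable {K : Type u} [Field K]

/-- The component at `ε` of the noise system associated with the contour `C`: the finitely generated
tame functors `G` for which `G(v ≤ C(v, ε))` is zero whenever `C(v, ε)` is finite. -/
def noise (C : Contour) (ε : ℚ≥0) : Set (PersFun K) :=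
  {G | IsFinGen G ∧ IsTame G ∧
    ∀ (v w : ℚ≥0) (h : v ≤ w), C.toFun v ε = (w : WithTop ℚ≥0) → G.map (homOfLE h) = 0}

/-- The tame subfunctors `G₀` of `G` for which `G / G₀` belongs to the component at `τ` of the noise
system associated with `C`. -/
def subDisc (C : Contour) (G : PersFun K) (τ : ℚ≥0) : Set (Subobject G) :=
  {G₀ | IsTame (G₀ : PersFun K) ∧ cokernel G₀.arrow ∈ C.noise τ}

/-- The `τ`-shift of `G`, for the noise system associated with `C`: the minimal element of
`C.subDisc G τ`. If `G` is finitely generated and tame, there is exactly one. -/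
noncomputable def shift (C : Contour) (G : PersFun K) (τ : ℚ≥0) : Subobject G :=
  have : Nonempty (Subobject G) := ⟨⊤⟩
  Classical.epsilon fun G₀ => Minimal (fun G₁ => G₁ ∈ C.subDisc G τ) G₀

end Contour

end Persistence

/-! A finitely generated tame functor is a finite direct sum of interval functors with supports `[b
j, d j)`, and its barcode, the multiset of pairs `(b j, d j)`, determines it up to isomorphism. It
is therefore enough to see that the ranks of the truncated shifts carry the same information as the
barcode.

Decomposition (`exists_isBarBasis`): inside the span of finitely many generators, the combinations
of degree at most `v` and the relations holding at `v` form two chains of subspaces as `v` grows. A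
basis adapted to both chains (`exists_adapted_set`) consists of the bars.

Shifts (`rank₀_shift`): the shift at `τ` truncated at `u` moves each birth from `b` to `b + τ` and
keeps exactly the bars with `b + τ < u` and `b + τ < d`. The rank of a barcode is its number of
bars, since its generators give a minimal cover.

Recovery (`exists_equiv_of_card_surviving`): varying `u` at fixed `τ` isolates the bars born at a
given `β` and dying after `β + τ`; varying `τ` then isolates their death. -/

namespace Persistence

/-! ### Bases adapted to two chains of subspaces -/

section LinearAlgebra

open Submodule

/-- Two chains of subspaces of a finite-dimensional space admit a common adapted basis, relative to
any subspace `H`. -/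
theorem exists_adapted_set {K V : Type*} [Field K] [AddCommGroup V] [Module K V]
    [FiniteDimensional K V] {S T : Set (Submodule K V)} (hS : IsChain (· ≤ ·) S)
    (hT : IsChain (· ≤ ·) T) (H : Submodule K V) :
    ∃ s : Set V, LinearIndepOn K id s ∧ span K s = H ∧
      ∀ W, W ∈ S ∨ W ∈ T → W ⊓ H ≤ span K (s ∩ W) := by
  induction H using WellFoundedLT.induction with
  | ind H ih =>
  rcases eq_or_ne H ⊥ with rfl | hH
  · exact ⟨∅, linearIndepOn_empty K id, by simp, by simp⟩
  -- `M` is the largest proper trace on `H` of a member of `S`, or `⊥` if there is none.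
  obtain ⟨M, hMH, hM⟩ : ∃ M < H, ∀ W ∈ S, H ≤ W ∨ W ⊓ H ≤ M := by
    by_cases hne : {X | ∃ W ∈ S, X = W ⊓ H ∧ ¬ H ≤ W}.Nonempty
    · obtain ⟨_, ⟨W, hW, rfl, hWH⟩, hmax⟩ := wellFounded_gt.has_min _ hne
      refine ⟨W ⊓ H, inf_lt_right.2 hWH, fun W' hW' => or_iff_not_imp_left.2 fun h => ?_⟩
      rcases hS.total hW hW' with hle | hle
      · by_contra hcon
        exact hmax _ ⟨W', hW', rfl, h⟩
          (lt_of_le_not_ge (inf_le_inf_right H hle) hcon)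
      · exact inf_le_inf_right H hle
    · refine ⟨⊥, bot_lt_iff_ne_bot.2 hH, fun W hW => or_iff_not_imp_left.2 fun h => ?_⟩
      exact absurd ⟨_, W, hW, rfl, h⟩ hne
  -- A maximal proper subspace of `H` above `M`: every member of `S` either contains `H` or has its
  -- trace in `H'`, so `S` puts no constraint on the new vector.
  obtain ⟨H', ⟨hMH', hH'⟩, hmax⟩ :=
    wellFounded_gt.has_min {X | M ≤ X ∧ X < H} ⟨M, le_rfl, hMH⟩
  obtain ⟨s, hs, hsH, hsW⟩ := ih H' hH'
  -- The new vector is taken in the smallest member of `T` whose trace on `H` leaves `H'`; every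
  -- other such member then contains it.
  obtain ⟨e, heH, heH', heT⟩ : ∃ e ∈ H, e ∉ H' ∧ ∀ W ∈ T, W ⊓ H ≤ H' ∨ e ∈ W := by
    by_cases hne : {W | W ∈ T ∧ ¬ W ⊓ H ≤ H'}.Nonempty
    · obtain ⟨W, ⟨hW, hWH⟩, hmin⟩ := wellFounded_lt.has_min _ hne
      obtain ⟨e, he, he'⟩ := SetLike.not_le_iff_exists.1 hWH
      refine ⟨e, he.2, he', fun W' hW' => or_iff_not_imp_left.2 fun h => ?_⟩
      rcases hT.total hW hW' with hle | hle
      · exact hle he.1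
      · by_contra hcon
        exact hmin W' ⟨hW', h⟩ (lt_of_le_not_ge hle fun h' => hcon (h' he.1))
    · obtain ⟨e, he, he'⟩ := SetLike.exists_of_lt hH'
      refine ⟨e, he, he', fun W hW => or_iff_not_imp_left.2 fun h => ?_⟩
      exact absurd ⟨W, hW, h⟩ hne
  have hspan : span K (insert e s) = H := by
    rw [span_insert, hsH, sup_comm]
    have hle : H' ⊔ span K {e} ≤ H := sup_le hH'.le (by simpa using heH)
    by_contra hcon
    refine hmax _ ⟨hMH'.trans le_sup_left, lt_of_le_of_ne hle hcon⟩ ?_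
    exact lt_of_le_not_ge le_sup_left fun h => heH' (h (mem_sup_right (mem_span_singleton_self e)))
  have hsub : ∀ W : Submodule K V, span K (s ∩ W) ≤ span K (insert e s ∩ W) := fun W =>
    span_mono (Set.inter_subset_inter_left _ (Set.subset_insert _ _))
  refine ⟨insert e s, ?_, hspan, ?_⟩
  · exact hs.id_insert (by rwa [hsH])
  · rintro W (hW | hW)
    · rcases hM W hW with h | h
      · have : insert e s ⊆ (W : Set V) := fun z hz => h (hspan ▸ subset_span hz)
        rw [Set.inter_eq_left.2 this, hspan]
        exact inf_le_right
      · exact (le_inf inf_le_left (h.trans hMH')).trans ((hsW W (.inl hW)).trans (hsub W))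
    · rcases heT W hW with h | h
      · exact (le_inf inf_le_left h).trans ((hsW W (.inr hW)).trans (hsub W))
      · rintro z ⟨hzW, hzH⟩
        rw [SetLike.mem_coe, ← hspan, mem_span_insert] at hzH
        obtain ⟨c, y, hy, rfl⟩ := hzH
        have hyW : y ∈ W := by simpa using W.sub_mem hzW (W.smul_mem c h)
        refine add_mem (smul_mem _ _ (subset_span ⟨Set.mem_insert _ _, h⟩)) ?_
        exact hsub W (hsW W (.inr hW) ⟨hyW, hsH ▸ hy⟩)

end LinearAlgebra

/-! ### Recovering a barcode from its survivor counts -/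

section Barcodes

theorem exists_gt_forall_lt_imp_le {J : Type*} [Finite J] (b : J → ℚ≥0) (β : ℚ≥0) :
    ∃ s, β < s ∧ ∀ j, b j < s → b j ≤ β := by
  have := Fintype.ofFinite J
  -- The extra element `β + 1` keeps the set nonempty when no value of `b` exceeds `β`.
  let A := insert (β + 1) ((Finset.univ.image b).filter (β < ·))
  have hA : A.Nonempty := Finset.insert_nonempty _ _
  refine ⟨A.min' hA, ?_, fun j hj => ?_⟩
  · rw [Finset.lt_min'_iff]
    intro y hy
    rcases Finset.mem_insert.1 hy with rfl | hy
    · exact lt_add_one β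
    · exact (Finset.mem_filter.1 hy).2
  · by_contra hcon
    refine absurd (Finset.min'_le A (b j) ?_) (not_le.2 hj)
    exact Finset.mem_insert_of_mem (Finset.mem_filter.2 ⟨by simp, not_le.1 hcon⟩)

theorem exists_lt_forall_lt_imp_le {J : Type*} [Finite J] (d : J → WithTop ℚ≥0) (β : ℚ≥0)
    {δ : WithTop ℚ≥0} (h : β < δ) :
    ∃ s : ℚ≥0, β ≤ s ∧ s < δ ∧ ∀ j, s < d j → δ ≤ d j := by
  have := Fintype.ofFinite J
  let A : Finset (WithTop ℚ≥0) := insert (β : WithTop ℚ≥0) ((Finset.univ.image d).filter (· < δ))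
  have hA : A.Nonempty := Finset.insert_nonempty _ _
  have hlt : A.max' hA < δ := by
    rw [Finset.max'_lt_iff]
    intro y hy
    rcases Finset.mem_insert.1 hy with rfl | hy
    · exact h
    · exact (Finset.mem_filter.1 hy).2
  obtain ⟨s, hs⟩ := WithTop.ne_top_iff_exists.1 hlt.ne_top
  refine ⟨s, ?_, hs ▸ hlt, fun j hj => ?_⟩
  · rw [← WithTop.coe_le_coe, hs]
    exact Finset.le_max' _ _ (Finset.mem_insert_self _ _)
  · by_contra hcon
    refine absurd (Finset.le_max' A (d j) ?_) (not_le.2 (hs ▸ hj))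
    exact Finset.mem_insert_of_mem (Finset.mem_filter.2 ⟨by simp, not_le.1 hcon⟩)

/-- The indices of the bars which survive the `τ`-shift truncated at `u`. -/
abbrev Surviving {J : Type*} (b : J → ℚ≥0) (d : J → WithTop ℚ≥0) (τ u : ℚ≥0) : Type _ :=
  {j : J // b j + τ < u ∧ ((b j + τ : ℚ≥0) : WithTop ℚ≥0) < d j}

/-- Raising the truncation from `β + τ` to `s + τ` admits just the bars born in `[β, s)`, hence at
`β`, that live past `β + τ`. -/
theorem card_birth_eq {J : Type*} [Finite J] {b : J → ℚ≥0} {d : J → WithTop ℚ≥0} {β τ s : ℚ≥0}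
    (hs : β < s) (h : ∀ j, b j < s → b j ≤ β) :
    Nat.card (Surviving b d τ (s + τ)) = Nat.card (Surviving b d τ (β + τ)) +
      Nat.card {j : J // b j = β ∧ ((β + τ : ℚ≥0) : WithTop ℚ≥0) < d j} := by
  have := Fintype.ofFinite J
  classical
  simp only [Nat.card_eq_fintype_card, Fintype.card_subtype]
  rw [← Finset.card_union_of_disjoint]
  · congr 1
    ext j
    simp only [Finset.mem_filter, Finset.mem_univ, true_and, Finset.mem_union, add_lt_add_iff_right]
    constructor
    · rintro ⟨h₁, h₂⟩
      rcases (h j h₁).lt_or_eq with h₃ | h₃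
      · exact .inl ⟨h₃, h₂⟩
      · exact .inr ⟨h₃, h₃ ▸ h₂⟩
    · rintro (⟨h₁, h₂⟩ | ⟨rfl, h₂⟩)
      · exact ⟨h₁.trans hs, h₂⟩
      · exact ⟨hs, h₂⟩
  · rw [Finset.disjoint_left]
    simp only [Finset.mem_filter, Finset.mem_univ, true_and, add_lt_add_iff_right]
    rintro j ⟨h₁, -⟩ ⟨h₂, -⟩
    exact h₁.ne h₂

/-- No death lies strictly between `s` and `δ`, so a bar living past `s` dies at `δ` or later. -/
theorem card_death_eq {J : Type*} [Finite J] {b : J → ℚ≥0} {d : J → WithTop ℚ≥0} {β s δ : ℚ≥0}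
    (hs : s < δ) (h : ∀ j, (s : WithTop ℚ≥0) < d j → δ ≤ d j) :
    Nat.card {j : J // b j = β ∧ (s : WithTop ℚ≥0) < d j} =
      Nat.card {j : J // b j = β ∧ (δ : WithTop ℚ≥0) < d j} +
        Nat.card {j : J // b j = β ∧ d j = δ} := by
  have := Fintype.ofFinite J
  classical
  simp only [Nat.card_eq_fintype_card, Fintype.card_subtype]
  rw [← Finset.card_union_of_disjoint]
  · congr 1
    ext j
    simp only [Finset.mem_filter, Finset.mem_univ, true_and, Finset.mem_union]
    constructor
    · rintro ⟨h₁, h₂⟩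
      rcases (h j h₂).lt_or_eq with h₃ | h₃
      · exact .inl ⟨h₁, h₃⟩
      · exact .inr ⟨h₁, h₃.symm⟩
    · rintro (⟨h₁, h₂⟩ | ⟨h₁, h₂⟩)
      · exact ⟨h₁, (WithTop.coe_lt_coe.2 hs).trans h₂⟩
      · exact ⟨h₁, h₂ ▸ WithTop.coe_lt_coe.2 hs⟩
  · rw [Finset.disjoint_left]
    simp only [Finset.mem_filter, Finset.mem_univ, true_and]
    rintro j ⟨-, h₁⟩ ⟨-, h₂⟩
    exact h₁.ne h₂.symm

/-- A finite barcode is determined by the numbers of bars surviving the truncated shifts. -/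
theorem exists_equiv_of_card_surviving {J J' : Type*} [Finite J] [Finite J']
    {b : J → ℚ≥0} {d : J → WithTop ℚ≥0} {b' : J' → ℚ≥0} {d' : J' → WithTop ℚ≥0}
    (hbd : ∀ j, (b j : WithTop ℚ≥0) < d j) (hbd' : ∀ j, (b' j : WithTop ℚ≥0) < d' j)
    (h : ∀ τ u, Nat.card (Surviving b d τ u) = Nat.card (Surviving b' d' τ u)) :
    ∃ e : J ≃ J', ∀ j, b' (e j) = b j ∧ d' (e j) = d j := by
  have hbirth : ∀ β σ : ℚ≥0, β ≤ σ → Nat.card {j : J // b j = β ∧ (σ : WithTop ℚ≥0) < d j} =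
      Nat.card {j : J' // b' j = β ∧ (σ : WithTop ℚ≥0) < d' j} := by
    intro β σ hσ
    obtain ⟨τ, rfl⟩ := exists_add_of_le hσ
    -- Joining the two barcodes yields one `s` that serves both.
    obtain ⟨s, hs, hsJ⟩ := exists_gt_forall_lt_imp_le (Sum.elim b b') β
    have h₁ := card_birth_eq (b := b) (d := d) (τ := τ) hs fun j => hsJ (.inl j)
    have h₂ := card_birth_eq (b := b') (d := d') (τ := τ) hs fun j => hsJ (.inr j)
    rw [h, h] at h₁
    omega
  have key : ∀ c : ℚ≥0 × WithTop ℚ≥0,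
      Nat.card {j : J // (b j, d j) = c} = Nat.card {j : J' // (b' j, d' j) = c} := by
    rintro ⟨β, δ⟩
    simp only [Prod.mk.injEq]
    by_cases hβ : (β : WithTop ℚ≥0) < δ
    · obtain ⟨s, hβs, hs, hsJ⟩ := exists_lt_forall_lt_imp_le (Sum.elim d d') β hβ
      have h₀ := hbirth β s hβs
      cases δ with
      | top =>
        -- Here `s` is past every finite death, so outliving it means never dying.
        have e₁ : ∀ j, (s : WithTop ℚ≥0) < d j ↔ d j = ⊤ := fun j =>
          ⟨fun hj => top_le_iff.1 (hsJ (.inl j) hj), fun hj => hj ▸ WithTop.coe_lt_top s⟩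
        have e₂ : ∀ j, (s : WithTop ℚ≥0) < d' j ↔ d' j = ⊤ := fun j =>
          ⟨fun hj => top_le_iff.1 (hsJ (.inr j) hj), fun hj => hj ▸ WithTop.coe_lt_top s⟩
        simpa only [e₁, e₂] using h₀
      | coe δ =>
        have hs' := WithTop.coe_lt_coe.1 hs
        have h₁ := card_death_eq (b := b) (d := d) (β := β) hs' fun j => hsJ (.inl j)
        have h₂ := card_death_eq (b := b') (d := d') (β := β) hs' fun j => hsJ (.inr j)
        have h₃ := hbirth β δ (hβs.trans hs'.le)
        omega
    · have e₁ : IsEmpty {j : J // b j = β ∧ d j = δ} :=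
        ⟨fun ⟨j, h₁, h₂⟩ => hβ (h₁ ▸ h₂ ▸ hbd j)⟩
      have e₂ : IsEmpty {j : J' // b' j = β ∧ d' j = δ} :=
        ⟨fun ⟨j, h₁, h₂⟩ => hβ (h₁ ▸ h₂ ▸ hbd' j)⟩
      rw [Nat.card_of_isEmpty, Nat.card_of_isEmpty]
  refine ⟨Equiv.ofFiberEquiv fun c => (Finite.card_eq.1 (key c)).some, fun j => ?_⟩
  exact Prod.mk.inj (Equiv.ofFiberEquiv_map (fun c => (Finite.card_eq.1 (key c)).some) j)

end Barcodes

variable {K : Type u} [Field K]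

/-! ### Transporting elements along the structure maps -/

section Push

/-- The image in `F.obj v` of an element `x` of `F.obj a`, and `0` unless `a ≤ v`. -/
noncomputable def push {F : PersFun K} {a : ℚ≥0} (x : F.obj a) (v : ℚ≥0) : F.obj v :=
  if h : a ≤ v then (F.map (homOfLE h)).hom x else 0

variable {F G : PersFun K}

theorem push_of_le {a v : ℚ≥0} (x : F.obj a) (h : a ≤ v) :
    push x v = (F.map (homOfLE h)).hom x := dif_pos h

theorem push_of_not_le {a v : ℚ≥0} (x : F.obj a) (h : ¬ a ≤ v) : push x v = 0 := dif_neg h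

theorem map_push {a v w : ℚ≥0} (x : F.obj a) (h : a ≤ v) (f : v ⟶ w) :
    (F.map f).hom (push x v) = push x w := by
  rw [push_of_le x h, push_of_le x (h.trans (leOfHom f)), ← LinearMap.comp_apply,
    ← ModuleCat.hom_comp, ← F.map_comp]
  rfl

@[simp]
theorem push_self {a : ℚ≥0} (x : F.obj a) : push x a = x := by
  rw [push_of_le x le_rfl]
  change (F.map (𝟙 a)).hom x = x
  simp

theorem push_push {a v w : ℚ≥0} (x : F.obj a) (h : a ≤ v) (h' : v ≤ w) :
    push (push x v) w = push x w := by
  rw [push_of_le _ h', map_push x h]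

theorem app_map (η : F ⟶ G) {v w : ℚ≥0} (f : v ⟶ w) (x : F.obj v) :
    (η.app w).hom ((F.map f).hom x) = (G.map f).hom ((η.app v).hom x) := by
  rw [← LinearMap.comp_apply, ← ModuleCat.hom_comp, η.naturality]
  rfl

theorem app_push (η : F ⟶ G) {a : ℚ≥0} (x : F.obj a) (v : ℚ≥0) :
    (η.app v).hom (push x v) = push ((η.app a).hom x) v := by
  by_cases h : a ≤ v
  · rw [push_of_le _ h, push_of_le _ h, app_map]
  · rw [push_of_not_le _ h, push_of_not_le _ h, map_zero]

theorem epi_iff_surjective (η : F ⟶ G) : Epi η ↔ ∀ v, Function.Surjective (η.app v).hom := by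
  rw [NatTrans.epi_iff_epi_app]
  exact forall_congr' fun v => ModuleCat.epi_iff_surjective _

theorem isIso_iff_bijective (η : F ⟶ G) : IsIso η ↔ ∀ v, Function.Bijective (η.app v).hom := by
  rw [NatTrans.isIso_iff_isIso_app]
  exact forall_congr' fun v => ConcreteCategory.isIso_iff_bijective _

end Push

/-! ### Free functors and uniqueness of the rank -/

section Free

variable {S : Type} {i : S → ℚ≥0} {F G : PersFun K}

/-- The generators of a free functor. -/
noncomputable def freeGen (K : Type u) [Field K] (i : S → ℚ≥0) (s : S) : (free K i).obj (i s) :=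
  Finsupp.single (⟨s, le_rfl⟩ : {t : S // i t ≤ i s}) (1 : K)

/-- The inclusion of the values of a free functor into their colimit. -/
noncomputable def freeIncl (K : Type u) [Field K] (i : S → ℚ≥0) (v : ℚ≥0) :
    (free K i).obj v →ₗ[K] S →₀ K :=
  Finsupp.lmapDomain K K Subtype.val

theorem push_freeGen {s : S} {v : ℚ≥0} (h : i s ≤ v) :
    push (freeGen K i s) v = Finsupp.single (⟨s, h⟩ : {t : S // i t ≤ v}) (1 : K) := by
  rw [push_of_le _ h]
  exact Finsupp.mapDomain_single

theorem freeIncl_injective (v : ℚ≥0) : Function.Injective (freeIncl K i v) :=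
  Finsupp.mapDomain_injective Subtype.val_injective

theorem freeIncl_map {v w : ℚ≥0} (f : v ⟶ w) (x : (free K i).obj v) :
    freeIncl K i w (((free K i).map f).hom x) = freeIncl K i v x := by
  exact (Finsupp.mapDomain_comp (v := (x : {t : S // i t ≤ v} →₀ K))).symm

theorem free_eq_sum {v : ℚ≥0} (x : (free K i).obj v) :
    x = (freeIncl K i v x).sum fun s c => c • push (freeGen K i s) v := by
  have h₁ := Finsupp.sum_mapDomain_index_inj (f := (Subtype.val : {t : S // i t ≤ v} → S))
    (s := (x : {t : S // i t ≤ v} →₀ K)) (h := fun s c => c • push (freeGen K i s) v)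
    Subtype.val_injective
  refine Eq.trans ?_ h₁.symm
  conv_lhs => rw [← Finsupp.sum_single (x : {t : S // i t ≤ v} →₀ K)]
  refine Finsupp.sum_congr fun s _ => ?_
  rw [push_freeGen s.2]
  exact (Finsupp.smul_single_one _ _).symm

theorem le_of_mem_support_freeIncl {v : ℚ≥0} (x : (free K i).obj v) {s : S}
    (hs : freeIncl K i v x s ≠ 0) : i s ≤ v := by
  by_contra h
  refine hs (Finsupp.mapDomain_of_notMem_range _ _ ?_)
  rintro ⟨t, rfl⟩
  exact h t.2

theorem freeIncl_freeGen {s : S} : freeIncl K i (i s) (freeGen K i s) = Finsupp.single s 1 :=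
  Finsupp.mapDomain_single

/-- The morphism from a free functor with prescribed values on the generators. -/
noncomputable def freeDesc (x : ∀ s, F.obj (i s)) : free K i ⟶ F where
  app v := ModuleCat.ofHom
    (Finsupp.linearCombination K fun s : {s : S // i s ≤ v} => push (x s) v)
  naturality v w f := by
    refine ModuleCat.hom_ext (Finsupp.lhom_ext' fun s => LinearMap.ext_ring ?_)
    change Finsupp.linearCombination K (fun s : {s : S // i s ≤ w} => push (x s) w)
      (Finsupp.mapDomain _ (Finsupp.single s 1)) =
      (F.map f).hom (Finsupp.linearCombination K (fun s : {s : S // i s ≤ v} => push (x s) v)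
        (Finsupp.single s 1))
    rw [Finsupp.mapDomain_single, Finsupp.linearCombination_single,
      Finsupp.linearCombination_single, one_smul, one_smul, map_push _ s.2]

theorem freeDesc_freeGen (x : ∀ s, F.obj (i s)) (s : S) :
    ((freeDesc x).app (i s)).hom (freeGen K i s) = x s := by
  change Finsupp.linearCombination K (fun t : {t : S // i t ≤ i s} => push (x t) (i s))
    (Finsupp.single _ 1) = _
  rw [Finsupp.linearCombination_single, one_smul, push_self]

theorem app_eq_sum (φ : free K i ⟶ F) {v : ℚ≥0} (x : (free K i).obj v) :
    (φ.app v).hom x = (freeIncl K i v x).sum fun s c =>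
      c • push ((φ.app (i s)).hom (freeGen K i s)) v := by
  conv_lhs => rw [free_eq_sum x, map_finsuppSum]
  simp only [map_smul, app_push]

theorem free_hom_ext {φ ψ : free K i ⟶ F}
    (h : ∀ s, (φ.app (i s)).hom (freeGen K i s) = (ψ.app (i s)).hom (freeGen K i s)) : φ = ψ := by
  refine NatTrans.ext (funext fun v => ModuleCat.hom_ext (LinearMap.ext fun x => ?_))
  rw [app_eq_sum, app_eq_sum]
  simp only [h]

theorem free_exists_lift (φ : free K i ⟶ F) (ψ : G ⟶ F) [Epi ψ] : ∃ f, f ≫ ψ = φ := by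
  have hψ := (epi_iff_surjective ψ).1 ‹_›
  choose y hy using fun s => hψ (i s) ((φ.app (i s)).hom (freeGen K i s))
  refine ⟨freeDesc y, free_hom_ext fun s => ?_⟩
  rw [← hy s, NatTrans.comp_app, ModuleCat.hom_comp, LinearMap.comp_apply, freeDesc_freeGen]

/-- Lifting each cover through the other gives an endomorphism over `F`, invertible by minimality of
`φ`. Its first factor is thus injective, and dimensions are compared in a degree where all
generators are present. -/
theorem card_le_card_of_isMinimalHom {S' : Type} [Fintype S] [Fintype S'] {i' : S' → ℚ≥0}
    {φ : free K i ⟶ F} (hφ : Epi φ) (hφ' : IsMinimalHom φ) {ψ : free K i' ⟶ F} (hψ : Epi ψ) :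
    Fintype.card S ≤ Fintype.card S' := by
  obtain ⟨f, hf⟩ := free_exists_lift φ ψ
  obtain ⟨g, hg⟩ := free_exists_lift ψ φ
  have hfg := hφ' (f ≫ g) (by rw [Category.assoc, hg, hf])
  let v := Finset.univ.sup i + Finset.univ.sup i'
  have hv : ∀ s, i s ≤ v := fun s =>
    (Finset.le_sup (Finset.mem_univ s)).trans (le_add_of_nonneg_right zero_le)
  have hv' : ∀ s, i' s ≤ v := fun s =>
    (Finset.le_sup (Finset.mem_univ s)).trans (le_add_of_nonneg_left zero_le)
  have hinj : Function.Injective (f.app v).hom := by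
    have := ((isIso_iff_bijective _).1 hfg v).1
    rw [NatTrans.comp_app, ModuleCat.hom_comp, LinearMap.coe_comp] at this
    exact this.of_comp
  classical
  let f' : ({s : S // i s ≤ v} →₀ K) →ₗ[K] ({s : S' // i' s ≤ v} →₀ K) := (f.app v).hom
  have := LinearMap.finrank_le_finrank_of_injective (f := f') hinj
  rwa [Module.finrank_finsupp_self, Module.finrank_finsupp_self,
    Fintype.card_congr (Equiv.subtypeUnivEquiv hv),
    Fintype.card_congr (Equiv.subtypeUnivEquiv hv')] at this

theorem rank₀_eq {n : ℕ} {i : Fin n → ℚ≥0} {φ : free K i ⟶ F} (hφ : IsMinimalCover φ) :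
    rank₀ F = n := by
  have hmem : n ∈ {n : ℕ | ∃ (i : Fin n → ℚ≥0) (φ : free K i ⟶ F), IsMinimalCover φ} :=
    ⟨i, φ, hφ⟩
  obtain ⟨i', ψ, hψ⟩ := Nat.sInf_mem ⟨n, hmem⟩
  refine le_antisymm (Nat.sInf_le hmem) ?_
  simpa [rank₀] using card_le_card_of_isMinimalHom hφ.1 hφ.2 hψ.1

end Free

/-! ### Interval decompositions and their minimal covers -/

/-- The elements `x j` of `F.obj (b j)` exhibit `F` as the direct sum of the interval functors with
supports `[b j, d j)`. -/
structure IsBarBasis (F : PersFun K) {J : Type*} (b : J → ℚ≥0) (d : J → WithTop ℚ≥0)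
    (x : ∀ j, F.obj (b j)) : Prop where
  birth_lt_death : ∀ j, (b j : WithTop ℚ≥0) < d j
  push_eq_zero : ∀ j (v : ℚ≥0), d j ≤ v → push (x j) v = 0
  linearIndepOn : ∀ v : ℚ≥0,
    LinearIndepOn K (fun j => push (x j) v) {j | b j ≤ v ∧ (v : WithTop ℚ≥0) < d j}
  span_eq_top : ∀ v, Submodule.span K (Set.range fun j => push (x j) v) = ⊤

namespace IsBarBasis

variable {F G : PersFun K} {J : Type*} {b : J → ℚ≥0} {d : J → WithTop ℚ≥0}
  {x : ∀ j, F.obj (b j)}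

theorem push_eq_zero_of_not_mem (h : IsBarBasis F b d x) {j : J} {v : ℚ≥0}
    (hj : ¬ (b j ≤ v ∧ (v : WithTop ℚ≥0) < d j)) : push (x j) v = 0 := by
  by_cases hb : b j ≤ v
  · exact h.push_eq_zero j v (not_lt.1 fun hd => hj ⟨hb, hd⟩)
  · exact push_of_not_le _ hb

theorem comp_equiv (h : IsBarBasis F b d x) {J' : Type*} (e : J' ≃ J) :
    IsBarBasis F (b ∘ e) (d ∘ e) (fun j => x (e j)) where
  birth_lt_death j := h.birth_lt_death (e j)
  push_eq_zero j v hv := h.push_eq_zero (e j) v hv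
  linearIndepOn v := by
    have := LinearIndependent.comp (h.linearIndepOn v)
      (fun j : {j | (b ∘ e) j ≤ v ∧ (v : WithTop ℚ≥0) < (d ∘ e) j} => ⟨e j.1, j.2⟩)
    exact this fun j j' hj => Subtype.ext (e.injective (congrArg Subtype.val hj))
  span_eq_top v := by
    have := h.span_eq_top v
    rwa [← e.surjective.range_comp] at this

theorem of_iso (h : IsBarBasis F b d x) (e : F ≅ G) :
    IsBarBasis G b d fun j => (e.hom.app (b j)).hom (x j) where
  birth_lt_death := h.birth_lt_death
  push_eq_zero j v hv := by rw [← app_push, h.push_eq_zero j v hv, map_zero]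
  linearIndepOn v := by
    have he := (isIso_iff_bijective e.hom).1 inferInstance v
    simp only [← app_push]
    exact (h.linearIndepOn v).map' (e.hom.app v).hom (LinearMap.ker_eq_bot.2 he.1)
  span_eq_top v := by
    have he := (isIso_iff_bijective e.hom).1 inferInstance v
    simp only [← app_push]
    rw [Set.range_comp' (e.hom.app v).hom, Submodule.span_image, h.span_eq_top, Submodule.map_top,
      LinearMap.range_eq_top.2 he.2]

/-- The basis of `F.obj v` given by the bars containing `v`. -/
noncomputable def basis (h : IsBarBasis F b d x) (v : ℚ≥0) :
    Module.Basis {j // b j ≤ v ∧ (v : WithTop ℚ≥0) < d j} K (F.obj v) :=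
  Module.Basis.mk (v := fun j => push (x j.1) v) (h.linearIndepOn v) <| by
    rw [← h.span_eq_top v, Submodule.span_le]
    rintro _ ⟨j, rfl⟩
    by_cases hj : b j ≤ v ∧ (v : WithTop ℚ≥0) < d j
    · exact Submodule.subset_span ⟨⟨j, hj⟩, rfl⟩
    · refine Set.mem_of_eq_of_mem (h.push_eq_zero_of_not_mem hj) (zero_mem _)

@[simp]
theorem basis_apply (h : IsBarBasis F b d x) (v : ℚ≥0) (j) : h.basis v j = push (x j.1) v :=
   Module.Basis.mk_apply _ _ j

theorem coord_push_self (h : IsBarBasis F b d x) {v : ℚ≥0}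
    (j : {j // b j ≤ v ∧ (v : WithTop ℚ≥0) < d j}) :
    (h.basis v).coord j (push (x j.1) v) = 1 := by
  rw [← h.basis_apply, Module.Basis.coord_apply, Module.Basis.repr_self, Finsupp.single_eq_same]

theorem coord_push_of_ne (h : IsBarBasis F b d x) {v : ℚ≥0}
    (j : {j // b j ≤ v ∧ (v : WithTop ℚ≥0) < d j}) {k : J} (hk : k ≠ j) :
    (h.basis v).coord j (push (x k) v) = 0 := by
  by_cases hkv : b k ≤ v ∧ (v : WithTop ℚ≥0) < d k
  · rw [← h.basis_apply v ⟨k, hkv⟩, Module.Basis.coord_apply, Module.Basis.repr_self,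
      Finsupp.single_eq_of_ne fun h' => hk (congrArg Subtype.val h').symm]
  · rw [h.push_eq_zero_of_not_mem hkv, map_zero]

theorem nonempty_iso {y : ∀ j, G.obj (b j)} (h : IsBarBasis F b d x) (h' : IsBarBasis G b d y) :
    Nonempty (F ≅ G) := by
  have key : ∀ v j, (h.basis v).equiv (h'.basis v) (Equiv.refl _) (push (x j) v) =
      push (y j) v := by
    intro v j
    by_cases hj : b j ≤ v ∧ (v : WithTop ℚ≥0) < d j
    · have := (h.basis v).equiv_apply ⟨j, hj⟩ (h'.basis v) (Equiv.refl _)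
      simpa using this
    · rw [h.push_eq_zero_of_not_mem hj, h'.push_eq_zero_of_not_mem hj, map_zero]
  refine ⟨NatIso.ofComponents
    (fun v => ((h.basis v).equiv (h'.basis v) (Equiv.refl _)).toModuleIso) fun {v w} f => ?_⟩
  refine ModuleCat.hom_ext ((h.basis v).ext fun j => ?_)
  simp only [basis_apply, ModuleCat.hom_comp, LinearMap.comp_apply]
  rw [map_push _ j.2.1]
  refine (key w j).trans ?_
  rw [← map_push _ j.2.1 f]
  congr 1
  exact (key v j).symm

/-- An endomorphism over `F` fixes each generator up to generators of strictly smaller birth. It is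
thus unitriangular, hence injective, and each value is finite-dimensional. -/
theorem isMinimalCover {J : Type} [Finite J] {b : J → ℚ≥0} {d : J → WithTop ℚ≥0}
    {x : ∀ j, F.obj (b j)} (h : IsBarBasis F b d x) : IsMinimalCover (freeDesc x) := by
  have hepi : Epi (freeDesc x) := by
    refine (epi_iff_surjective _).2 fun v => ?_
    rw [← LinearMap.range_eq_top, eq_top_iff, ← h.span_eq_top v, Submodule.span_le]
    rintro _ ⟨j, rfl⟩
    refine ⟨push (freeGen K b j) v, ?_⟩
    rw [app_push, freeDesc_freeGen]
  refine ⟨hepi, fun f hf => ?_⟩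
  -- A bar born exactly at `v` is alive there, so its generator cannot occur in a kernel element at
  -- `v`.
  have hker : ∀ (v : ℚ≥0) (z : (free K b).obj v), ((freeDesc x).app v).hom z = 0 →
      ∀ j, freeIncl K b v z j ≠ 0 → b j < v := by
    intro v z hz j hj
    have hjv := le_of_mem_support_freeIncl z hj
    by_contra hcon
    have hv : (v : WithTop ℚ≥0) < d j := by
      rw [← le_antisymm hjv (not_lt.1 hcon)]
      exact h.birth_lt_death j
    refine hj ?_
    rw [app_eq_sum] at hz
    replace hz := congrArg ((h.basis v).coord ⟨j, hjv, hv⟩) hz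
    rw [map_zero, Finsupp.sum, map_sum, Finset.sum_eq_single j] at hz
    · rwa [map_smul, freeDesc_freeGen, h.coord_push_self ⟨j, hjv, hv⟩, smul_eq_mul, mul_one] at hz
    · intro k _ hk
      rw [map_smul, freeDesc_freeGen, h.coord_push_of_ne ⟨j, hjv, hv⟩ hk, smul_zero]
    · intro hj'
      rw [Finsupp.notMem_support_iff.1 hj', zero_smul, map_zero]
  have hgen : ∀ j k, freeIncl K b (b k) ((f.app (b k)).hom (freeGen K b k)) j ≠
      (Finsupp.single k 1 : J →₀ K) j → b j < b k := by
    intro j k hjk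
    refine hker (b k) ((f.app (b k)).hom (freeGen K b k) - freeGen K b k) ?_ j ?_
    · rw [map_sub, sub_eq_zero]
      conv_rhs => rw [← hf]
      rw [NatTrans.comp_app, ModuleCat.hom_comp, LinearMap.comp_apply]
    · rw [map_sub, freeIncl_freeGen]
      exact sub_ne_zero.2 hjk
  rw [isIso_iff_bijective]
  intro v
  let f' : ({s : J // b s ≤ v} →₀ K) →ₗ[K] ({s : J // b s ≤ v} →₀ K) := (f.app v).hom
  suffices hinj : Function.Injective f' from
    ⟨hinj, (LinearMap.injective_iff_surjective (f := f')).1 hinj⟩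
  rw [injective_iff_map_eq_zero]
  change ∀ z : (free K b).obj v, (f.app v).hom z = 0 → z = 0
  intro z hz
  by_contra hne
  have hsupp : (freeIncl K b v z).support.Nonempty := by
    rw [Finsupp.support_nonempty_iff]
    exact fun h0 => hne (freeIncl_injective v (h0.trans (map_zero _).symm))
  -- At a generator of latest birth in the support, no other term can contribute, so `f` preserves
  -- that coefficient.
  obtain ⟨j, hj, hmax⟩ := Finset.exists_max_image _ b hsupp
  have hcoef : freeIncl K b v ((f.app v).hom z) j = freeIncl K b v z j := by
    rw [app_eq_sum, Finsupp.sum, map_sum, Finset.sum_apply']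
    rw [Finset.sum_eq_single j]
    · rw [map_smul, Finsupp.smul_apply,
        push_of_le _ (le_of_mem_support_freeIncl z (Finsupp.mem_support_iff.1 hj)), freeIncl_map]
      rw [not_ne_iff.1 fun h' => (hgen j j h').false]
      simp
    · intro k hk hkj
      rw [map_smul, Finsupp.smul_apply,
        push_of_le _ (le_of_mem_support_freeIncl z (Finsupp.mem_support_iff.1 hk)), freeIncl_map]
      rw [not_ne_iff.1 fun h' => (hmax k hk).not_gt (hgen j k h')]
      simp [Finsupp.single_eq_of_ne hkj.symm]
    · exact fun h' => absurd hj h'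
  rw [hz, map_zero] at hcoef
  exact Finsupp.mem_support_iff.1 hj hcoef.symm

theorem rank₀_eq [Finite J] (h : IsBarBasis F b d x) : rank₀ F = Nat.card J :=
  Persistence.rank₀_eq (h.comp_equiv (Finite.equivFin J).symm).isMinimalCover

end IsBarBasis

/-! ### Tameness as constancy on a grid -/

section Tame

variable {F G : PersFun K}

/-- The structure maps of `F` within each interval `[k / N, (k + 1) / N)` are isomorphisms. -/
def IsConstOn (F : PersFun K) (N : ℕ) : Prop :=
  ∀ ⦃v w : ℚ≥0⦄ (f : v ⟶ w), ⌊v * N⌋₊ = ⌊w * N⌋₊ → IsIso (F.map f)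

/-- Grids can be refined, so two tame functors have a common one. -/
theorem IsConstOn.mul {N : ℕ} (h : IsConstOn F N) {M : ℕ} (hM : 0 < M) : IsConstOn F (N * M) := by
  intro v w f hvw
  refine h f ?_
  have key : ∀ v : ℚ≥0, ⌊v * N⌋₊ = ⌊v * (N * M : ℕ)⌋₊ / M := by
    intro v
    rw [← Nat.floor_div_natCast, Nat.cast_mul, ← mul_assoc, mul_div_cancel_right₀]
    exact_mod_cast hM.ne'
  rw [key, key, hvw]

/-- For `α = p / q`, the number `⌊v / α⌋` is the integer quotient of `⌊v * q⌋` by `p`, so the grid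
of step `1 / q` works. -/
theorem IsTame.exists_isConstOn (h : IsTame F) : ∃ N : ℕ, 0 < N ∧ IsConstOn F N := by
  obtain ⟨α, hα, F', ⟨e⟩⟩ := h
  have hα' : α = α.num / α.den := (NNRat.num_div_den α).symm
  refine ⟨α.den, α.den_pos, fun v w f hvw => ?_⟩
  have hfloor : ∀ v : ℚ≥0, ⌊v / α⌋₊ = ⌊v * α.den⌋₊ / α.num := by
    intro v
    rw [← Nat.floor_div_natCast]
    conv_lhs => rw [hα', div_div_eq_mul_div]
  rw [NatIso.isIso_map_iff e]
  have : IsIso ((floorFunctor α).map f) :=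
    ⟨homOfLE (by
      change ⌊w / α⌋₊ ≤ ⌊v / α⌋₊
      rw [hfloor, hfloor, hvw]), Subsingleton.elim _ _, Subsingleton.elim _ _⟩
  exact inferInstanceAs (IsIso (F'.map ((floorFunctor α).map f)))

theorem IsConstOn.isTame {N : ℕ} (hN : 0 < N) (h : IsConstOn F N) : IsTame F := by
  have hN' : (0 : ℚ≥0) < N := Nat.cast_pos.2 hN
  have hdiv : ∀ v : ℚ≥0, v / (N : ℚ≥0)⁻¹ = v * N := fun v => by rw [div_inv_eq_mul]
  -- The frame samples `F` at the grid points `n / N`.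
  refine ⟨(N : ℚ≥0)⁻¹, inv_pos.2 hN', Monotone.functor (f := fun n : ℕ => (n / N : ℚ≥0))
    (fun m n hmn => div_le_div_of_nonneg_right (Nat.cast_le.2 hmn) zero_le) ⋙ F, ⟨Iso.symm ?_⟩⟩
  have hle : ∀ v : ℚ≥0, ((⌊v / (N : ℚ≥0)⁻¹⌋₊ : ℕ) / N : ℚ≥0) ≤ v := by
    intro v
    rw [hdiv, div_le_iff₀ hN']
    exact Nat.floor_le zero_le
  have hiso : ∀ v : ℚ≥0, IsIso (F.map (homOfLE (hle v))) := by
    intro v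
    refine h _ ?_
    rw [div_mul_cancel₀ _ hN'.ne', Nat.floor_natCast, hdiv]
  refine NatIso.ofComponents (fun v => @asIso _ _ _ _ (F.map (homOfLE (hle v))) (hiso v)) fun {v w} f => ?_
  change F.map _ ≫ F.map (homOfLE (hle w)) = F.map (homOfLE (hle v)) ≫ F.map f
  exact (F.map_comp _ _).symm.trans
    ((congrArg F.map (Subsingleton.elim _ _)).trans (F.map_comp _ _))

/-- Within a cell of a common grid the structure maps of both functors are bijective, hence so is
the induced map on cokernels. -/
theorem isTame_cokernel (hF : IsTame F) (hG : IsTame G) (η : F ⟶ G) : IsTame (cokernel η) := by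
  obtain ⟨M, hM, hFM⟩ := hF.exists_isConstOn
  obtain ⟨N, hN, hGN⟩ := hG.exists_isConstOn
  replace hFM := hFM.mul hN
  replace hGN := mul_comm M N ▸ hGN.mul hM
  refine IsConstOn.isTame (Nat.mul_pos hM hN) fun v w f hvw => ?_
  have h₁ := hFM f hvw
  have h₂ := hGN f hvw
  rw [ConcreteCategory.isIso_iff_bijective] at h₁ h₂ ⊢
  have hπ : ∀ v, Function.Surjective ((cokernel.π η).app v).hom :=
    (epi_iff_surjective _).1 inferInstance
  constructor
  · refine (injective_iff_map_eq_zero ((cokernel η).map f).hom).2 fun z hz => ?_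
    obtain ⟨y, rfl⟩ := hπ v z
    have hex := ((ShortComplex.exact_cokernel η).map ((evaluation _ _).obj w))
    rw [ShortComplex.moduleCat_exact_iff] at hex
    rw [← app_map] at hz
    obtain ⟨t, ht⟩ := hex _ hz
    obtain ⟨t, rfl⟩ := h₁.2 t
    have h₃ : (G.map f).hom ((η.app v).hom t) = (G.map f).hom y := by
      rw [← app_map]
      exact ht
    rw [← h₂.1 h₃, ← LinearMap.comp_apply, ← ModuleCat.hom_comp, ← NatTrans.comp_app,
      cokernel.condition]
    rfl
  · intro z
    obtain ⟨y, rfl⟩ := hπ w z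
    obtain ⟨y, rfl⟩ := h₂.2 y
    exact ⟨((cokernel.π η).app v).hom y, (app_map _ _ _).symm⟩

theorem IsFinGen.of_epi (hF : IsFinGen F) (η : F ⟶ G) [Epi η] : IsFinGen G := by
  obtain ⟨n, i, φ, hφ⟩ := hF
  exact ⟨n, i, φ ≫ η, inferInstance⟩

theorem exists_mul_eq_natCast {J : Type*} [Finite J] (q : J → ℚ≥0) :
    ∃ N : ℕ, 0 < N ∧ ∀ j, ∃ k : ℕ, q j * N = k := by
  have := Fintype.ofFinite J
  refine ⟨∏ j, (q j).den, Finset.prod_pos fun j _ => (q j).den_pos, fun j => ?_⟩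
  obtain ⟨m, hm⟩ := Finset.dvd_prod_of_mem (fun j => (q j).den) (Finset.mem_univ j)
  refine ⟨(q j).num * m, ?_⟩
  rw [hm, Nat.cast_mul, Nat.cast_mul, ← mul_assoc, NNRat.mul_den_eq_num]

theorem IsBarBasis.isTame {J : Type*} [Finite J] {b : J → ℚ≥0} {d : J → WithTop ℚ≥0}
    {x : ∀ j, F.obj (b j)} (h : IsBarBasis F b d x) : IsTame F := by
  -- A common denominator of all finite endpoints; the default `0` for an infinite death is
  -- harmless.
  obtain ⟨N, hN, hNq⟩ := exists_mul_eq_natCast (Sum.elim b fun j => (d j).untopD 0)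
  have hN' : (0 : ℚ≥0) < N := Nat.cast_pos.2 hN
  have hle : ∀ {v w q : ℚ≥0}, ⌊v * N⌋₊ = ⌊w * N⌋₊ → (∃ k : ℕ, q * N = k) → (q ≤ v ↔ q ≤ w) := by
    rintro v w q hvw ⟨k, hk⟩
    rw [← (mul_le_mul_iff_left₀ hN' : q * N ≤ v * N ↔ q ≤ v),
      ← (mul_le_mul_iff_left₀ hN' : q * N ≤ w * N ↔ q ≤ w), hk, ← Nat.le_floor_iff zero_le,
      ← Nat.le_floor_iff zero_le, hvw]
  refine IsConstOn.isTame hN fun v w f hvw => ?_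
  have hmem : ∀ j, (b j ≤ v ∧ (v : WithTop ℚ≥0) < d j) ↔ b j ≤ w ∧ (w : WithTop ℚ≥0) < d j := by
    intro j
    refine and_congr (hle hvw (hNq (.inl j))) ?_
    have hd := hle hvw (hNq (.inr j))
    simp only [Sum.elim_inr] at hd
    cases hdj : d j with
    | top => simp
    | coe δ =>
      rw [hdj, WithTop.untopD_coe] at hd
      rw [WithTop.coe_lt_coe, WithTop.coe_lt_coe, ← not_le, ← not_le, hd]
  rw [ConcreteCategory.isIso_iff_bijective]
  have hsurj : Function.Surjective (F.map f).hom := by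
    rw [← LinearMap.range_eq_top, eq_top_iff, ← h.span_eq_top w, Submodule.span_le]
    rintro _ ⟨j, rfl⟩
    by_cases hj : b j ≤ w ∧ (w : WithTop ℚ≥0) < d j
    · exact ⟨push (x j) v, map_push _ ((hmem j).2 hj).1 f⟩
    · exact Set.mem_of_eq_of_mem (h.push_eq_zero_of_not_mem hj) (zero_mem _)
  have := Module.Basis.finiteDimensional_of_finite (h.basis v)
  have := Module.Basis.finiteDimensional_of_finite (h.basis w)
  refine ⟨(LinearMap.injective_iff_surjective_of_finrank_eq_finrank ?_).2 hsurj, hsurj⟩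
  rw [Module.finrank_eq_nat_card_basis (h.basis v), Module.finrank_eq_nat_card_basis (h.basis w)]
  exact Nat.card_congr (Equiv.subtypeEquivRight hmem)

end Tame

/-! ### Existence of interval decompositions -/

section Decomposition

open Submodule

variable {F : PersFun K} {n : ℕ} {i : Fin n → ℚ≥0}

/-- The degree of a linear combination of generators, those of degree at most `v` making sense in
`F.obj v`. -/
noncomputable def degree (i : Fin n → ℚ≥0) (e : Fin n →₀ K) : ℚ≥0 := e.support.sup i

theorem degree_le_iff {e : Fin n →₀ K} {v : ℚ≥0} :
    degree i e ≤ v ↔ e ∈ Finsupp.supported K K {s | i s ≤ v} := by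
  rw [degree, Finset.sup_le_iff, Finsupp.mem_supported]
  rfl

/-- The value in `F.obj v` of a linear combination of generators, those of degree larger than `v`
being ignored. -/
noncomputable def value (y : ∀ s, F.obj (i s)) (v : ℚ≥0) : (Fin n →₀ K) →ₗ[K] F.obj v :=
  Finsupp.linearCombination K fun s => push (y s) v

theorem push_value (y : ∀ s, F.obj (i s)) {e : Fin n →₀ K} {v w : ℚ≥0} (h : degree i e ≤ v)
    (hvw : v ≤ w) : push (value y v e) w = value y w e := by
  rw [push_of_le _ hvw, value, value, Finsupp.linearCombination_apply,
    Finsupp.linearCombination_apply, map_finsuppSum]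
  refine Finsupp.sum_congr fun s hs => ?_
  rw [map_smul, map_push _ ((Finset.le_sup hs).trans h)]

/-- Tameness makes the first vanishing time attained: a combination that is zero at `v` is already
zero at the grid point below `v`, or at its own degree if that is later. This is why bars are closed
on the left and open on the right. -/
theorem exists_death (hF : IsTame F) (y : ∀ s, F.obj (i s)) (e : Fin n →₀ K) :
    ∃ d : WithTop ℚ≥0, ∀ v : ℚ≥0, degree i e ≤ v → (d ≤ v ↔ value y v e = 0) := by
  obtain ⟨N, hN, hFN⟩ := hF.exists_isConstOn
  have hN' : (0 : ℚ≥0) < N := Nat.cast_pos.2 hN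
  let t : ℕ → ℚ≥0 := fun k => max (degree i e) (k / N)
  have key : ∀ v : ℚ≥0, degree i e ≤ v → value y v e = 0 → t ⌊v * N⌋₊ ≤ v ∧
      value y (t ⌊v * N⌋₊) e = 0 := by
    intro v hv h0
    have hfl : (⌊v * N⌋₊ / N : ℚ≥0) ≤ v := by
      rw [div_le_iff₀ hN']
      exact Nat.floor_le zero_le
    have hle : t ⌊v * N⌋₊ ≤ v := max_le hv hfl
    refine ⟨hle, ?_⟩
    have hiso := hFN (homOfLE hle) <| by
      refine le_antisymm (Nat.floor_mono (mul_le_mul_of_nonneg_right hle zero_le)) ?_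
      refine Nat.le_floor ?_
      rw [← div_le_iff₀ hN']
      exact le_max_right _ _
    rw [ConcreteCategory.isIso_iff_bijective] at hiso
    refine hiso.1 ?_
    rw [← push_value y (le_max_left _ _) hle, push_of_le _ hle] at h0
    exact h0.trans (map_zero (F.map (homOfLE hle)).hom).symm
  by_cases hex : ∃ k, value y (t k) e = 0
  · classical
    refine ⟨t (Nat.find hex), fun v hv => ?_⟩
    rw [WithTop.coe_le_coe]
    constructor
    · intro hle
      rw [← push_value y (le_max_left _ _) hle, Nat.find_spec hex, push_of_le _ hle, map_zero]
    · intro h0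
      obtain ⟨h₁, h₂⟩ := key v hv h0
      refine le_trans (max_le_max le_rfl ?_) h₁
      exact div_le_div_of_nonneg_right (Nat.cast_le.2 (Nat.find_min' hex h₂)) zero_le
  · refine ⟨⊤, fun v hv => ⟨fun h => absurd h (WithTop.coe_lt_top v).not_ge, fun h0 => ?_⟩⟩
    exact absurd ⟨_, (key v hv h0).2⟩ hex

theorem IsFinGen.exists_generators (hF : IsFinGen F) :
    ∃ (n : ℕ) (i : Fin n → ℚ≥0) (y : ∀ s, F.obj (i s)),
      ∀ v, span K (Set.range fun s => push (y s) v) = ⊤ := by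
  obtain ⟨n, i, φ, hφ⟩ := hF
  refine ⟨n, i, fun s => (φ.app (i s)).hom (freeGen K i s), fun v => ?_⟩
  rw [eq_top_iff]
  intro z _
  obtain ⟨z, rfl⟩ := (epi_iff_surjective φ).1 hφ v z
  rw [app_eq_sum]
  exact sum_mem fun s _ => smul_mem _ _ (subset_span ⟨s, rfl⟩)

/-- A finitely generated tame functor is a finite direct sum of interval functors. -/
theorem exists_isBarBasis (hF : IsFinGen F) (hF' : IsTame F) :
    ∃ (J : Type u) (_ : Finite J) (b : J → ℚ≥0) (d : J → WithTop ℚ≥0) (x : ∀ j, F.obj (b j)),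
      IsBarBasis F b d x := by
  obtain ⟨n, i, y, hy⟩ := hF.exists_generators
  let V : ℚ≥0 → Submodule K (Fin n →₀ K) := fun v => Finsupp.supported K K {s | i s ≤ v}
  let R : ℚ≥0 → Submodule K (Fin n →₀ K) := fun v => V v ⊓ LinearMap.ker (value y v)
  have hV : Monotone V := fun v w h => Finsupp.supported_mono fun s hs => le_trans hs h
  have hR : Monotone R := by
    rintro v w h e ⟨he, h0⟩
    refine ⟨hV h he, ?_⟩
    rw [SetLike.mem_coe, LinearMap.mem_ker] at h0 ⊢
    rw [← push_value y (degree_le_iff.2 he) h, h0, push_of_le _ h, map_zero]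
  -- The two chains are the degree filtration `V` and the relations `R`.
  obtain ⟨s, hs, -, hsW⟩ := exists_adapted_set hV.isChain_range hR.isChain_range ⊤
  have hsV : ∀ v, V v ≤ span K (s ∩ V v) := fun v => by
    simpa only [inf_top_eq] using hsW (V v) (.inl ⟨v, rfl⟩)
  have hsR : ∀ v, R v ≤ span K (s ∩ R v) := fun v => by
    simpa only [inf_top_eq] using hsW (R v) (.inr ⟨v, rfl⟩)
  choose d hd using exists_death hF' y
  have hfin : Finite s := hs.finite
  have hlt : ∀ {e : Fin n →₀ K} {v : ℚ≥0}, degree i e ≤ v →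
      ((v : WithTop ℚ≥0) < d e ↔ value y v e ≠ 0) := fun he => by
    rw [← not_le, hd _ _ he]
  -- Basis vectors whose value is already zero at their own degree would give empty bars and are
  -- dropped.
  refine ⟨{e : s // ((degree i e.1 : ℚ≥0) : WithTop ℚ≥0) < d e.1}, inferInstance,
    fun e => degree i e.1.1, fun e => d e.1.1, fun e => value y _ e.1.1, ⟨fun e => e.2, ?_, ?_, ?_⟩⟩
  · intro e v hv
    have hle := WithTop.coe_le_coe.1 (e.2.le.trans hv)
    rw [push_value y le_rfl hle, (hd _ v hle).1 hv]
  · intro v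
    let A : Set (Fin n →₀ K) := {e | e ∈ V v ∧ value y v e ≠ 0}
    -- A kernel element in the span of the live vectors is a relation, hence also in the span of `s
    -- ∩ R v`; these two parts of the independent set `s` are disjoint.
    have hdisj : Disjoint (span K (s ∩ A)) (LinearMap.ker (value y v)) := by
      have h₁ : Disjoint (span K (s ∩ A)) (span K (s ∩ R v)) := by
        have := hs.linearIndependent.disjoint_span_image (s := {e | e.1 ∈ A})
          (t := {e | e.1 ∈ (R v : Set (Fin n →₀ K))})
          (Set.disjoint_left.2 fun e h₁ h₂ => h₁.2 h₂.2)
        change Disjoint (span K (Subtype.val '' (Subtype.val ⁻¹' A)))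
          (span K (Subtype.val '' (Subtype.val ⁻¹' (R v : Set (Fin n →₀ K))))) at this
        rwa [Subtype.image_preimage_coe, Subtype.image_preimage_coe] at this
      rw [disjoint_iff_inf_le] at h₁ ⊢
      refine le_trans (le_inf inf_le_left (le_trans (le_inf ?_ inf_le_right) (hsR v))) h₁
      exact inf_le_left.trans (span_le.2 fun e he => he.2.1)
    have hli : LinearIndependent K fun e : ↥(s ∩ A) => value y v e.1 :=
      (hs.mono Set.inter_subset_left).linearIndependent.map (f := value y v) (by simpa using hdisj)
    let I := {e : {e : s // ((degree i e.1 : ℚ≥0) : WithTop ℚ≥0) < d e.1} //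
      degree i e.1.1 ≤ v ∧ (v : WithTop ℚ≥0) < d e.1.1}
    let g : I → ↥(s ∩ A) := fun e =>
      ⟨e.1.1.1, e.1.1.2, degree_le_iff.1 e.2.1, (hlt e.2.1).1 e.2.2⟩
    have hg : Function.Injective g := fun e e' h =>
      Subtype.ext (Subtype.ext (Subtype.ext (show (g e).1 = (g e').1 by rw [h])))
    refine (congrArg (fun g : I → F.obj v => LinearIndependent K g) (funext fun e => ?_)).mpr
      (hli.comp g hg)
    exact push_value y le_rfl e.2.1
  · intro v
    rw [eq_top_iff, ← hy v, span_le]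
    have hle : V v ≤ (span K (Set.range fun e :
        {e : s // ((degree i e.1 : ℚ≥0) : WithTop ℚ≥0) < d e.1} =>
          push (value y (degree i e.1.1) e.1.1) v)).comap (value y v) := by
      refine (hsV v).trans (span_le.2 fun e ⟨hes, heV⟩ => ?_)
      have hdeg := degree_le_iff.2 heV
      rw [SetLike.mem_coe, mem_comap, ← push_value y le_rfl hdeg]
      by_cases he : value y (degree i e) e = 0
      · rw [he, push_of_le _ hdeg, map_zero]
        exact zero_mem _
      · exact subset_span ⟨⟨⟨e, hes⟩, (hlt le_rfl).2 he⟩, rfl⟩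
    rintro _ ⟨t, rfl⟩
    by_cases ht : i t ≤ v
    · have := hle (Finsupp.single_mem_supported K (1 : K) (show t ∈ {s | i s ≤ v} from ht))
      rwa [mem_comap, value, Finsupp.linearCombination_single, one_smul] at this
    · exact Set.mem_of_eq_of_mem (push_of_not_le _ ht) (zero_mem _)

end Decomposition

/-! ### Subfunctors generated by a family of elements -/

section Generated

open Submodule

variable {F G : PersFun K} {J : Type*} {a : J → ℚ≥0}

theorem map_mem_span_push (x : ∀ j, F.obj (a j)) {v w : ℚ≥0} (f : v ⟶ w) {z : F.obj v}
    (hz : z ∈ span K (Set.range fun j => push (x j) v)) :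
    (F.map f).hom z ∈ span K (Set.range fun j => push (x j) w) := by
  suffices span K (Set.range fun j => push (x j) v) ≤
      (span K (Set.range fun j => push (x j) w)).comap (F.map f).hom from this hz
  refine span_le.2 ?_
  rintro _ ⟨j, rfl⟩
  by_cases hj : a j ≤ v
  · exact subset_span ⟨j, (map_push (x j) hj f).symm⟩
  · rw [SetLike.mem_coe, mem_comap, show (F.map f).hom (push (x j) v) = 0 by
      rw [push_of_not_le _ hj, map_zero]]
    exact zero_mem _

/-- The subfunctor of `F` generated by the elements `x j`. -/
noncomputable def generated (x : ∀ j, F.obj (a j)) : PersFun K where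
  obj v := ModuleCat.of K (span K (Set.range fun j => push (x j) v))
  map {v w} f := ModuleCat.ofHom ((F.map f).hom.restrict fun _ => map_mem_span_push x f)
  map_id v := by
    refine ModuleCat.hom_ext (LinearMap.ext fun z => Subtype.ext ?_)
    change (F.map (𝟙 v)).hom z.1 = z.1
    rw [F.map_id]
    rfl
  map_comp f g := by
    refine ModuleCat.hom_ext (LinearMap.ext fun z => Subtype.ext ?_)
    change (F.map (f ≫ g)).hom z.1 = (F.map g).hom ((F.map f).hom z.1)
    rw [F.map_comp]
    rfl

/-- The inclusion of the subfunctor generated by a family of elements. -/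
noncomputable def generatedIncl (x : ∀ j, F.obj (a j)) : generated x ⟶ F where
  app v := ModuleCat.ofHom (span K (Set.range fun j => push (x j) v)).subtype
  naturality _ _ _ := rfl

variable (x : ∀ j, F.obj (a j))

theorem generatedIncl_injective (v : ℚ≥0) :
    Function.Injective ((generatedIncl x).app v).hom :=
  Subtype.val_injective

instance : Mono (generatedIncl x) := by
  rw [NatTrans.mono_iff_mono_app]
  exact fun v => (ModuleCat.mono_iff_injective _).2 (generatedIncl_injective x v)

/-- The generators of `generated x`. -/
noncomputable def generator (j : J) : (generated x).obj (a j) :=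
  (⟨x j, subset_span ⟨j, push_self (x j)⟩⟩ : span K (Set.range fun k => push (x k) (a j)))

theorem generatedIncl_push_generator (j : J) (v : ℚ≥0) :
    ((generatedIncl x).app v).hom (push (generator x j) v) = push (x j) v :=
  app_push _ _ _

theorem span_generator (v : ℚ≥0) :
    span K (Set.range fun j => push (generator x j) v) = ⊤ := by
  refine map_injective_of_injective (f := ((generatedIncl x).app v).hom)
    (generatedIncl_injective x v) ?_
  rw [map_span, ← Set.range_comp, Submodule.map_top]
  simp only [Function.comp_def, generatedIncl_push_generator]
  exact (Submodule.range_subtype _).symm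

theorem generated_hom_ext {η θ : generated x ⟶ G}
    (h : ∀ j, (η.app (a j)).hom (generator x j) = (θ.app (a j)).hom (generator x j)) : η = θ := by
  refine NatTrans.ext (funext fun v => ModuleCat.hom_ext
    (LinearMap.ext_on_range (span_generator x v) fun j => ?_))
  rw [app_push, app_push, h]

end Generated

/-! ### The truncated shift of a barcode -/

namespace IsBarBasis

variable {F : PersFun K} {J : Type*} {b : J → ℚ≥0} {d : J → WithTop ℚ≥0} {x : ∀ j, F.obj (b j)}

/-- The generators of the `τ`-shift truncated at `u`. -/
noncomputable abbrev shiftGen (x : ∀ j, F.obj (b j)) (d : J → WithTop ℚ≥0) (τ u : ℚ≥0)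
    (j : Surviving b d τ u) : F.obj (b j.1 + τ) :=
  push (x j.1) (b j.1 + τ)

theorem push_shiftGen {τ u : ℚ≥0} (j : Surviving b d τ u) {v : ℚ≥0} (h : b j.1 + τ ≤ v) :
    push (shiftGen x d τ u j) v = push (x j.1) v :=
  push_push _ (le_add_of_nonneg_right zero_le) h

theorem generated_shiftGen (h : IsBarBasis F b d x) (τ u : ℚ≥0) :
    IsBarBasis (generated (shiftGen x d τ u)) (fun j : Surviving b d τ u => b j.1 + τ)
      (fun j => d j.1)
      (generator (shiftGen x d τ u)) where
  birth_lt_death j := j.2.2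
  push_eq_zero j v hv := by
    refine generatedIncl_injective _ v ?_
    rw [generatedIncl_push_generator, map_zero]
    have hle := WithTop.coe_le_coe.1 (j.2.2.le.trans hv)
    rw [push_shiftGen j hle, h.push_eq_zero _ _ hv]
  linearIndepOn v := by
    have h₁ : LinearIndependent K fun j : {j : Surviving b d τ u //
        b j.1 + τ ≤ v ∧ (v : WithTop ℚ≥0) < d j.1} =>
        ((generatedIncl (shiftGen x d τ u)).app v).hom
          (push (generator (shiftGen x d τ u) j.1) v) := by
      have h₂ := LinearIndependent.comp (h.linearIndepOn v)
        (fun j : {j : Surviving b d τ u // b j.1 + τ ≤ v ∧ (v : WithTop ℚ≥0) < d j.1} =>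
          ⟨j.1.1, (le_add_of_nonneg_right zero_le).trans j.2.1, j.2.2⟩)
        fun j j' hj => Subtype.ext (Subtype.ext (congrArg (fun z => z.1) hj))
      refine (congrArg (fun g : {j : Surviving b d τ u //
        b j.1 + τ ≤ v ∧ (v : WithTop ℚ≥0) < d j.1} → F.obj v => LinearIndependent K g)
        (funext fun j => ?_)).mpr h₂
      rw [generatedIncl_push_generator, push_shiftGen _ j.2.1]
      rfl
    exact h₁.of_comp ((generatedIncl (shiftGen x d τ u)).app v).hom
  span_eq_top := span_generator _

/-- A morphism to a functor in the truncated noise system vanishes on the shift. -/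
theorem shiftGen_comp_eq_zero (x : ∀ j, F.obj (b j)) {τ u : ℚ≥0} {G : PersFun K} (η : F ⟶ G)
    (hG : G ∈ (Contour.standard.truncate u).noise τ) :
    generatedIncl (shiftGen x d τ u) ≫ η = 0 := by
  refine generated_hom_ext _ fun j => ?_
  have hle : b j.1 ≤ b j.1 + τ := le_add_of_nonneg_right zero_le
  have h₀ := hG.2.2 (b j.1) (b j.1 + τ) hle (by
    refine if_neg (not_le.2 ?_)
    exact WithTop.coe_lt_coe.2 j.2.1)
  change (η.app _).hom (push (x j.1) (b j.1 + τ)) = 0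
  rw [app_push, push_of_le _ hle, h₀]
  rfl

/-- For `w = v + τ < u`, a bar born by `v` either satisfies `d ≤ b + τ` and is dead at `w`, or
survives, and its element at `w` lies in the shift, which `η` kills. -/
theorem mem_noise (h : IsBarBasis F b d x) (hF : IsFinGen F) {τ u : ℚ≥0} {G : PersFun K}
    (hG : IsTame G) (η : F ⟶ G) [Epi η] (hη : generatedIncl (shiftGen x d τ u) ≫ η = 0) :
    G ∈ (Contour.standard.truncate u).noise τ := by
  refine ⟨hF.of_epi η, hG, ?_⟩
  intro v w hvw hC
  obtain ⟨hw, hwu⟩ : w = v + τ ∧ w < u := by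
    change (if (u : WithTop ℚ≥0) ≤ (v : WithTop ℚ≥0) + τ then ⊤ else (v : WithTop ℚ≥0) + τ) = w
      at hC
    split_ifs at hC with hu
    · exact absurd hC.symm (WithTop.coe_ne_top)
    · have := WithTop.coe_inj.1 ((WithTop.coe_add v τ).trans hC)
      exact ⟨this.symm, WithTop.coe_lt_coe.1 (hC ▸ not_le.1 hu)⟩
  refine ModuleCat.hom_ext (LinearMap.ext fun z => ?_)
  obtain ⟨z, rfl⟩ := (epi_iff_surjective η).1 inferInstance v z
  rw [← app_map]
  have key : (F.map (homOfLE hvw) ≫ η.app w).hom = 0 := by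
    refine LinearMap.ext_on_range (h.span_eq_top v) fun j => ?_
    rw [ModuleCat.hom_comp, LinearMap.comp_apply]
    by_cases hj : b j ≤ v
    · rw [map_push _ hj]
      have hjw : b j + τ ≤ w := hw ▸ add_le_add_left hj τ
      by_cases hd : ((b j + τ : ℚ≥0) : WithTop ℚ≥0) < d j
      · let k : Surviving b d τ u := ⟨j, hjw.trans_lt hwu, hd⟩
        rw [← push_shiftGen k hjw, ← generatedIncl_push_generator, ← LinearMap.comp_apply,
          ← ModuleCat.hom_comp, ← NatTrans.comp_app, hη]
        rfl
      · rw [h.push_eq_zero j w ((not_lt.1 hd).trans (WithTop.coe_le_coe.2 hjw)), map_zero]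
        rfl
    · rw [push_of_not_le _ hj, map_zero, map_zero]
      rfl
  exact LinearMap.congr_fun key z

theorem isLeast_subDisc [Finite J] (h : IsBarBasis F b d x) (hF : IsFinGen F) (hF' : IsTame F)
    (τ u : ℚ≥0) : IsLeast ((Contour.standard.truncate u).subDisc F τ)
      (Subobject.mk (generatedIncl (shiftGen x d τ u))) := by
  have hbar := (h.generated_shiftGen τ u).of_iso
    (Subobject.underlyingIso (generatedIncl (shiftGen x d τ u))).symm
  refine ⟨⟨hbar.isTame, ?_⟩, fun G₀ hG₀ => ?_⟩
  · refine h.mem_noise hF (isTame_cokernel hbar.isTame hF' _) (cokernel.π _) ?_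
    refine (congrArg (· ≫ cokernel.π _)
      (Subobject.underlyingIso_arrow (generatedIncl (shiftGen x d τ u))).symm).trans ?_
    simp only [Category.assoc, cokernel.condition, comp_zero]
  -- `G₀` is the kernel of its cokernel map, which vanishes on the shift.
  · have h0 := shiftGen_comp_eq_zero (d := d) x (cokernel.π G₀.arrow) hG₀.2
    refine Subobject.mk_le_of_comm (Abelian.monoLift G₀.arrow _ h0) ?_
    exact Abelian.monoLift_comp _ _ _

theorem rank₀_shift [Finite J] (h : IsBarBasis F b d x) (hF : IsFinGen F) (hF' : IsTame F)
    (τ u : ℚ≥0) : rank₀ ((Contour.standard.truncate u).shift F τ : PersFun K) =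
      Nat.card (Surviving b d τ u) := by
  have hleast := h.isLeast_subDisc hF hF' τ u
  have hshift : (Contour.standard.truncate u).shift F τ =
      Subobject.mk (generatedIncl (shiftGen x d τ u)) := by
    have hmin : Minimal (fun G₁ => G₁ ∈ (Contour.standard.truncate u).subDisc F τ)
        ((Contour.standard.truncate u).shift F τ) :=
      Classical.epsilon_spec (p := fun G₀ =>
        Minimal (fun G₁ => G₁ ∈ (Contour.standard.truncate u).subDisc F τ) G₀)
        ⟨_, hleast.minimal⟩
    -- A least element is the only minimal one, so the choice made by `Classical.epsilon` is forced.
    exact hmin.eq_of_ge hleast.1 (hleast.2 hmin.1)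
  rw [hshift]
  exact ((h.generated_shiftGen τ u).of_iso
    (Subobject.underlyingIso (generatedIncl (shiftGen x d τ u))).symm).rank₀_eq

end IsBarBasis

end Persistence

theorem mainTheorem6 {K : Type u} [Field K] (F G : ℚ≥0 ⥤ ModuleCat.{u} K)
    (hF : Persistence.IsFinGen F) (hF' : Persistence.IsTame F)
    (hG : Persistence.IsFinGen G) (hG' : Persistence.IsTame G) :
    Nonempty (F ≅ G) ↔
      ∀ τ u : ℚ≥0,
        Persistence.rank₀
            ((Persistence.Contour.standard.truncate u).shift F τ : ℚ≥0 ⥤ ModuleCat.{u} K) =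
          Persistence.rank₀
            ((Persistence.Contour.standard.truncate u).shift G τ : ℚ≥0 ⥤ ModuleCat.{u} K) := by
  obtain ⟨J, _, b, d, x, hx⟩ := Persistence.exists_isBarBasis hF hF'
  constructor
  · rintro ⟨e⟩ τ u
    -- An isomorphism carries the bar basis to one with the same endpoints, so both ranks count the
    -- same set.
    rw [hx.rank₀_shift hF hF', (hx.of_iso e).rank₀_shift hG hG']
  · intro h
    obtain ⟨J', _, b', d', y, hy⟩ := Persistence.exists_isBarBasis hG hG'
    obtain ⟨e, he⟩ := Persistence.exists_equiv_of_card_surviving hx.birth_lt_death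
      hy.birth_lt_death fun τ u => by
        rw [← hx.rank₀_shift hF hF', h, hy.rank₀_shift hG hG']
    obtain rfl : b' ∘ e = b := funext fun j => (he j).1
    obtain rfl : d' ∘ e = d := funext fun j => (he j).2
    exact hx.nonempty_iso (hy.comp_equiv e)
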